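/- A compact space $K$ is *fragmentable* if there is a metric $d$ on the set $K$ (not necessarily related to the topology of $K$) such that for every non-empty $M\subseteq K$ and every $\varepsilon>0$ there is an open set $U\subseteq K$ with $M\cap U\neq\varnothing$ and $d\text{-}\mathrm{diam}(M\cap U)<\varepsilon$. The *topological weight* of $K$ is the least cardinality of a base of its topology. We say that a linearly ordered set $K$ *contains a copy* of an ordinal $\kappa$ if some subset of $K$ is order-isomorphic either to $\kappa$ or to $\kappa$ with its order reversed. **Proposition.** Let $K$ be a linearly ordered set that is compact in its order topology and is fragmentable. If $\kappa$ is a regular uncountable cardinal and $K$ contains no copy of $\kappa$ (regarded as an initial ordinal), then the topological weight of $K$ is strictly less than $\kappa$. In particular, if $K$ contains no copy of $\omega_1$, then $K$ is metrisable. -/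

import Mathlib

open Cardinal Ordinal Topology TopologicalSpace

universe u v

/-- A topological space `K` is fragmentable if there is a metric `d` on `K` (whose own topology
need not be related to the given topology `τ`) such that every non-empty `M ⊆ K` has, for each
`ε > 0`, a non-empty `τ`-relatively open subset `M ∩ U` of `d`-diameter less than `ε`. The diameter
is the extended one, so that a `d`-unbounded set has infinite diameter. -/
def Fragmentable (K : Type u) [τ : TopologicalSpace K] : Prop :=
  ∃ d : MetricSpace K, ∀ M : Set K, M.Nonempty → ∀ ε : ℝ, 0 < ε →
    ∃ U : Set K, IsOpen[τ] U ∧ (M ∩ U).Nonempty ∧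
      @Metric.ediam K d.toPseudoMetricSpace.toPseudoEMetricSpace (M ∩ U) < ENNReal.ofReal ε

/-- The topological weight: the least cardinality of a base of the topology. -/
noncomputable def topWeight (K : Type u) [TopologicalSpace K] : Cardinal.{u} :=
  sInf {c | ∃ B : Set (Set K), IsTopologicalBasis B ∧ #B = c}

/-- The linear order `K` contains a copy of the ordinal `o`: some subset of `K` is
order-isomorphic to `o` or to `o` with its order reversed. -/
def ContainsCopy (o : Ordinal.{v}) (K : Type u) [LinearOrder K] : Prop :=
  Nonempty (o.ToType ↪o K) ∨ Nonempty (o.ToTypeᵒᵈ ↪o K)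

/-!
Fragmentability supplies, for each `ε > 0`, an ordinal-valued rank `ρ` on `K` whose sublevel sets
`{x | ρ x < ξ}` are open and on whose fibres any two points have `d`-distance less than `ε`:
exhaust `K` transfinitely by open sets, adding at each stage an open set which meets what is left in a `d`-small set
(`exists_ordinal_rank_of_fragmented`). With `ε = 1 / (n + 1)` these ranks `ρ n` together separate
the points of `K` (`Fragmentable.exists_ranks`).

For a point `p` and an ordinal `ξ`, consider how far to the right of `p` one can go inside
`{x | ρ n x < ξ}`, that is, the supremum of the `r ≥ p` with `[p, r]` contained in this set. The
supremum increases with `ξ`, so for fixed `p` and `n` its values form a well-ordered subset of `K`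
(`isWF_reachLUBs`), which has fewer than `κ` elements because `K` contains no copy of `κ`. The same
holds to the left, because `K` contains no reversed copy of `κ`. Since `κ` is regular and
uncountable, there is a set `N` of fewer than `κ` points that contains all these values for each of
its own points `p`, together with a set cofinal in `(-∞, p)` and one coinitial in `(p, ∞)`.

The rays with end points in such an `N` generate the topology. Otherwise
(`exists_mem_Ico_of_closed`) there is a gap `a < b` of `N`: no point of `N` lies strictly between
`a` and `b`, and both are limits of points of `N` from outside, or belong to `N`. Choose `n` with
`ρ n a ≠ ρ n b`, say `ρ n a < ρ n b`. Then `{x | ρ n x < ρ n b}` is a neighbourhood of `a` that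
misses `b`, so it contains `[p, a]` for some `p ∈ N`, and the right reach of `p` in it is a point
of `N ∩ [a, b]` (`exists_reachLUB_mem_Icc`). It must be `a` or `b`, and then cofinality or
coinitiality at that point puts into `N` a further point that the gap does not allow.
-/

open Set

/-! ### Ranks from fragmentability -/

/-- A space in which every nonempty set has a nonempty relatively open subset that is small of
order `s` carries an ordinal rank with open strict sublevel sets and with fibres small of
order `s`. -/
theorem exists_ordinal_rank_of_fragmented {K : Type u} [TopologicalSpace K] {s : Set (K × K)}
    (h : ∀ M : Set K, M.Nonempty → ∃ U : Set K, IsOpen U ∧ (M ∩ U).Nonempty ∧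
      (M ∩ U) ×ˢ (M ∩ U) ⊆ s) :
    ∃ ρ : K → Ordinal.{u}, (∀ ξ, IsOpen {x | ρ x < ξ}) ∧ ∀ x y, ρ x = ρ y → (x, y) ∈ s := by
  classical
  have h' : ∀ M : Set K, ∃ U : Set K, IsOpen U ∧ (M.Nonempty → (M ∩ U).Nonempty) ∧
      (M ∩ U) ×ˢ (M ∩ U) ⊆ s := by
    intro M
    by_cases hM : M.Nonempty
    · obtain ⟨U, h1, h2, h3⟩ := h M hM
      exact ⟨U, h1, fun _ => h2, h3⟩
    · exact ⟨∅, isOpen_empty, fun h => absurd h hM, by simp⟩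
  choose V hVo hVn hVs using h'
  -- `W ξ` is the open set exhausted before stage `ξ`; stage `η` adds `V (W η)ᶜ` to `W η`.
  let W : Ordinal.{u} → Set K :=
    WellFounded.fix (C := fun _ => Set K) Ordinal.lt_wf
      fun ξ W => ⋃ η : Iio ξ, W η.1 η.2 ∪ V (W η.1 η.2)ᶜ
  have hW : ∀ ξ, W ξ = ⋃ η : Iio ξ, W η ∪ V (W η)ᶜ := fun ξ =>
    WellFounded.fix_eq (C := fun _ => Set K) Ordinal.lt_wf
      (fun ξ W => ⋃ η : Iio ξ, W η.1 η.2 ∪ V (W η.1 η.2)ᶜ) ξ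
  have hsub : ∀ {η ξ}, η < ξ → W η ∪ V (W η)ᶜ ⊆ W ξ := fun {η ξ} hlt => by
    rw [hW ξ]
    exact subset_iUnion (fun η : Iio ξ => W η ∪ V (W η)ᶜ) ⟨η, hlt⟩
  have hWo : ∀ ξ, IsOpen (W ξ) := fun ξ => by
    induction ξ using WellFoundedLT.induction with
    | ind ξ ih =>
      rw [hW ξ]
      exact isOpen_iUnion fun η => (ih η.1 η.2).union (hVo _)
  have hcov : ∃ ξ, W ξ = Set.univ := by
    by_contra! hne
    -- Otherwise each stage contributes a new point, and the ordinals inject into `K`.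
    have hne' : ∀ ξ, ∃ x, x ∈ V (W ξ)ᶜ ∧ x ∉ W ξ := fun ξ => by
      obtain ⟨x, hx, hx'⟩ := hVn _ (nonempty_compl.2 (hne ξ))
      exact ⟨x, hx', hx⟩
    choose g hgV hgW using hne'
    refine not_injective_of_ordinal g fun ξ η hg => ?_
    by_contra hξη
    rcases lt_or_gt_of_ne hξη with hlt | hlt
    · exact hgW η (hg ▸ hsub hlt (Or.inr (hgV ξ)))
    · exact hgW ξ (hg ▸ hsub hlt (Or.inr (hgV η)))
  obtain ⟨ζ, hζ⟩ := hcov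
  have hex : ∀ x : K, ∃ ξ, x ∈ W ξ ∪ V (W ξ)ᶜ := fun x => ⟨ζ, Or.inl (hζ ▸ mem_univ x)⟩
  let ρ : K → Ordinal.{u} := fun x => sInf {ξ | x ∈ W ξ ∪ V (W ξ)ᶜ}
  have hρ : ∀ x, x ∈ W (ρ x) ∪ V (W (ρ x))ᶜ := fun x => csInf_mem (hex x)
  have hlt : ∀ x ξ, ρ x < ξ ↔ x ∈ W ξ := by
    intro x ξ
    refine ⟨fun h => hsub h (hρ x), fun h => ?_⟩
    rw [hW ξ, mem_iUnion] at h
    obtain ⟨η, hη⟩ := h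
    have hle : ρ x ≤ η := csInf_le' (s := {ξ | x ∈ W ξ ∪ V (W ξ)ᶜ}) hη
    exact hle.trans_lt η.2
  have hnot : ∀ x, x ∉ W (ρ x) := fun x hx => lt_irrefl _ ((hlt x _).2 hx)
  refine ⟨ρ, fun ξ => ?_, fun x y hxy => ?_⟩
  · convert hWo ξ using 1
    exact Set.ext fun x => hlt x ξ
  · refine hVs (W (ρ x))ᶜ ⟨⟨hnot x, (hρ x).resolve_left (hnot x)⟩, ?_, ?_⟩
    · rw [hxy]; exact hnot y
    · rw [hxy]; exact (hρ y).resolve_left (hnot y)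

/-- A fragmentable space has countably many ordinal ranks with open strict sublevel sets which
together separate points. -/
theorem Fragmentable.exists_ranks {K : Type u} [TopologicalSpace K] (h : Fragmentable K) :
    ∃ ρ : ℕ → K → Ordinal.{u}, (∀ n ξ, IsOpen {x | ρ n x < ξ}) ∧
      ∀ x y, x ≠ y → ∃ n, ρ n x ≠ ρ n y := by
  obtain ⟨d, hd⟩ := h
  have key : ∀ n : ℕ, ∃ ρ : K → Ordinal.{u}, (∀ ξ, IsOpen {x | ρ x < ξ}) ∧
      ∀ x y, ρ x = ρ y → (x, y) ∈ {p : K × K | d.dist p.1 p.2 < 1 / ((n : ℝ) + 1)} := by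
    intro n
    refine exists_ordinal_rank_of_fragmented fun M hM => ?_
    obtain ⟨U, hU, hne, hdiam⟩ := hd M hM (1 / ((n : ℝ) + 1)) (by positivity)
    refine ⟨U, hU, hne, ?_⟩
    rintro ⟨x, y⟩ ⟨hx, hy⟩
    have h2 := (Metric.edist_le_ediam_of_mem hx hy).trans_lt hdiam
    rw [edist_dist, ENNReal.ofReal_lt_ofReal_iff (by positivity)] at h2
    exact h2
  choose ρ hρ hρ' using key
  refine ⟨ρ, hρ, fun x y hxy => ?_⟩
  by_contra! hall
  obtain ⟨n, hn⟩ := exists_nat_one_div_lt (dist_pos.2 hxy)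
  exact lt_asymm hn (hρ' n x y (hall n))

/-! ### Small well-ordered and cofinal sets -/

theorem Set.IsWF.mk_lt_of_isEmpty {K : Type u} [LinearOrder K] {κ : Cardinal.{u}}
    (hκ : IsEmpty (κ.ord.ToType ↪o K)) {S : Set K} (hS : S.IsWF) : #S < κ := by
  by_contra! hle
  have : WellFoundedLT S := ⟨hS⟩
  have h1 : typeLT κ.ord.ToType ≤ typeLT S := by
    rw [type_toType]
    exact (ord_le_ord.2 hle).trans (ord_le_type _)
  obtain ⟨f⟩ := type_le_iff'.1 h1
  exact hκ.false ((OrderEmbedding.ofStrictMono (fun x => f x) fun a b h => f.map_rel_iff.2 h).trans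
    (OrderEmbedding.subtype S))

/-- In a linear order without a copy of `κ`, every initial segment `Iio x` has a cofinal subset of
fewer than `κ` elements, because every linear order has a well-ordered cofinal subset. If `x` has a
predecessor, the cofinal set contains it. -/
theorem exists_cofinal_mk_lt {K : Type u} [LinearOrder K] {κ : Cardinal.{u}}
    (hκ : IsEmpty (κ.ord.ToType ↪o K)) (x : K) :
    ∃ C : Set K, #C < κ ∧ ∀ y < x, ∃ c ∈ C, y ≤ c ∧ c < x := by
  -- The records of a well-ordering `r`: they are cofinal, and on them `<` is contained in `r`.
  let r : Iio x → Iio x → Prop := WellOrderingRel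
  let T : Set (Iio x) := {a | ∀ b, r b a → b < a}
  have hT : IsCofinal T := isCofinal_setOfPred_imp_lt r
  have hwf : T.IsWF := by
    have : ∀ a b : T, a < b → r a b := by
      intro a b hab
      rcases trichotomous_of r a.1 b.1 with h | h | h
      · exact h
      · exact absurd (Subtype.ext h) hab.ne
      · exact absurd (a.2 _ h) (not_lt.2 (le_of_lt hab))
    exact Subrelation.wf (fun {a b} h => this a b h)
      (InvImage.wf (Subtype.val : T → Iio x) (IsWellFounded.wf (r := r)))
  have hempty : IsEmpty (κ.ord.ToType ↪o Iio x) :=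
    ⟨fun f => hκ.false (f.trans (OrderEmbedding.subtype _))⟩
  refine ⟨Subtype.val '' T, mk_image_le.trans_lt (hwf.mk_lt_of_isEmpty hempty), fun y hy => ?_⟩
  obtain ⟨c, hc, hyc⟩ := hT ⟨y, hy⟩
  exact ⟨c, ⟨c, hc, rfl⟩, hyc, c.2⟩

/-! ### Reach of a point in the sublevel sets of a rank -/

/-- The points `r ≥ p` for which the interval `[p, r]` is contained in `{x | ρ x < ξ}`. -/
def reach {K : Type u} [Preorder K] (ρ : K → Ordinal.{u}) (p : K) (ξ : Ordinal.{u}) : Set K :=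
  {r | p ≤ r ∧ ∀ x ∈ Icc p r, ρ x < ξ}

/-- The suprema of the sets `reach ρ p ξ`, as `ξ` ranges over the ordinals. Using the relation
`IsLUB` avoids choosing a complete lattice structure on `K`. The infima of the points reached to
the left of `p` are the elements of `reachLUBs (K := Kᵒᵈ) ρ p`. -/
def reachLUBs {K : Type u} [Preorder K] (ρ : K → Ordinal.{u}) (p : K) : Set K :=
  {s | ∃ ξ, IsLUB (reach ρ p ξ) s}

theorem reach_mono {K : Type u} [Preorder K] (ρ : K → Ordinal.{u}) (p : K) :
    Monotone (reach ρ p) :=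
  fun _ _ h _ hr => ⟨hr.1, fun x hx => (hr.2 x hx).trans_le h⟩

theorem isWF_reachLUBs {K : Type u} [LinearOrder K] (ρ : K → Ordinal.{u}) (p : K) :
    (reachLUBs ρ p).IsWF := by
  choose ξ hξ using fun s : reachLUBs ρ p => s.2
  have : StrictMono ξ := by
    intro s t hst
    by_contra! hle
    exact absurd (isLUB_le_iff (hξ t) |>.2 fun r hr => (hξ s).1 (reach_mono ρ p hle hr))
      (not_le.2 hst)
  exact this.wellFoundedLT.wf

theorem exists_isLUB_of_compactSpace {K : Type u} [LinearOrder K] [TopologicalSpace K]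
    [OrderTopology K] [CompactSpace K] {S : Set K} (hS : S.Nonempty) : ∃ a, IsLUB S a := by
  obtain ⟨a, -, ha⟩ := (isClosed_closure (s := S)).isCompact.exists_isLUB hS.closure
  exact ⟨a, by rwa [IsLUB, upperBounds_closure] at ha⟩

/-- If `a < b`, `ρ a < ρ b` and `a` is a supremum of points of a set `N` that is closed under
`reachLUBs ρ`, then `N` has a point in `[a, b]`: the supremum of what some `p ∈ N` near `a` reaches
inside `{x | ρ x < ρ b}`. -/
theorem exists_reachLUB_mem_Icc {K : Type u} [LinearOrder K] [TopologicalSpace K]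
    [OrderTopology K] [CompactSpace K] {ρ : K → Ordinal.{u}}
    (hρ : ∀ ξ, IsOpen {x | ρ x < ξ}) {N S : Set K} {a b : K} (hSN : S ⊆ N) (hSne : S.Nonempty)
    (hN : ∀ p ∈ N, reachLUBs ρ p ⊆ N) (ha : IsLUB S a) (hab : a < b) (hlt : ρ a < ρ b) :
    ∃ r ∈ N, a ≤ r ∧ r ≤ b := by
  have hU : {x | ρ x < ρ b} ∈ 𝓝 a := (hρ (ρ b)).mem_nhds hlt
  obtain ⟨p, hpS, hpU⟩ : ∃ p ∈ S, ∀ x ∈ Icc p a, ρ x < ρ b := by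
    by_cases hbot : ∃ l, l < a
    · obtain ⟨l, hl, hlU⟩ := exists_Ioc_subset_of_mem_nhds hU hbot
      obtain ⟨p, hp, hlp, -⟩ := ha.exists_between hl
      exact ⟨p, hp, fun x hx => hlU ⟨hlp.trans_le hx.1, hx.2⟩⟩
    · -- Here `a` is the least point of `K`, so every `p ∈ S` equals `a`.
      push Not at hbot
      obtain ⟨p, hp⟩ := hSne
      refine ⟨p, hp, fun x hx => ?_⟩
      rwa [le_antisymm hx.2 (hbot x)]
  have har : a ∈ reach ρ p (ρ b) := ⟨ha.1 hpS, hpU⟩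
  obtain ⟨r, hr⟩ := exists_isLUB_of_compactSpace ⟨a, har⟩
  refine ⟨r, hN p (hSN hpS) ⟨_, hr⟩, hr.1 har, hr.2 fun t ht => ?_⟩
  by_contra! hbt
  exact lt_irrefl _ (ht.2 b ⟨(ha.1 hpS).trans hab.le, hbt.le⟩)

/-! ### Closing off and counting -/

theorem exists_superset_closed_mk_lt {K : Type u} {κ : Cardinal.{u}} (hreg : κ.IsRegular)
    (hunc : ℵ₀ < κ) {F : K → Set K} (hF : ∀ x, #(F x) < κ) {S : Set K} (hS : #S < κ) :
    ∃ N : Set K, S ⊆ N ∧ #N < κ ∧ ∀ x ∈ N, F x ⊆ N := by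
  let A : ℕ → Set K := fun n => (fun T : Set K => ⋃ x ∈ T, F x)^[n] S
  have hsucc : ∀ n, A (n + 1) = ⋃ x ∈ A n, F x := fun n =>
    Function.iterate_succ_apply' (fun T : Set K => ⋃ x ∈ T, F x) n S
  have hA : ∀ n, #(A n) < κ := fun n => by
    induction n with
    | zero => exact hS
    | succ n ih =>
      rw [hsucc]
      exact (card_biUnion_lt_iff_forall_of_isRegular hreg ih).2 fun x _ => hF x
  refine ⟨⋃ n : ULift.{u} ℕ, A n.down, ?_, ?_, ?_⟩
  · exact subset_iUnion (fun n : ULift.{u} ℕ => A n.down) ⟨0⟩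
  · exact (card_iUnion_lt_iff_forall_of_isRegular hreg (by simpa using hunc)).2 fun n => hA _
  · intro x hx
    obtain ⟨⟨n⟩, hn⟩ := mem_iUnion.1 hx
    have hsub : F x ⊆ A (n + 1) := by
      rw [hsucc]
      exact subset_biUnion_of_mem (u := F) hn
    exact hsub.trans (subset_iUnion (fun n : ULift.{u} ℕ => A n.down) ⟨n + 1⟩)

/-- If `N` meets every `[y, x)` and every `(y, x]`, then the rays with end points in `N` form a
subbasis of the order topology, so there is a base of fewer than `κ` sets. -/
theorem isTopologicalBasis_mk_lt {K : Type u} [LinearOrder K] [t : TopologicalSpace K]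
    [OrderTopology K] {κ : Cardinal.{u}} (hunc : ℵ₀ < κ) {N : Set K} (hN : #N < κ)
    (h1 : ∀ y x, y < x → ∃ c ∈ N, y ≤ c ∧ c < x) (h2 : ∀ y x, y < x → ∃ c ∈ N, y < c ∧ c ≤ x) :
    ∃ B : Set (Set K), IsTopologicalBasis B ∧ #B < κ := by
  let s : Set (Set K) := Ioi '' N ∪ Iio '' N
  have hs : t = generateFrom s := by
    refine le_antisymm (le_generateFrom ?_) ?_
    · rintro _ (⟨c, -, rfl⟩ | ⟨c, -, rfl⟩)
      exacts [isOpen_Ioi, isOpen_Iio]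
    · rw [OrderTopology.topology_eq_generate_intervals (α := K)]
      refine le_generateFrom ?_
      rintro _ ⟨y, rfl | rfl⟩
      · have : Ioi y = ⋃₀ {V | ∃ c ∈ N, y ≤ c ∧ V = Ioi c} := by
          ext x
          constructor
          · intro hx
            obtain ⟨c, hc, hyc, hcx⟩ := h1 y x hx
            exact ⟨_, ⟨c, hc, hyc, rfl⟩, hcx⟩
          · rintro ⟨_, ⟨c, hc, hyc, rfl⟩, hcx⟩
            exact lt_of_le_of_lt hyc hcx
        rw [this]
        refine @isOpen_sUnion _ (generateFrom s) _ ?_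
        rintro _ ⟨c, hc, -, rfl⟩
        exact isOpen_generateFrom_of_mem (Or.inl ⟨c, hc, rfl⟩)
      · have : Iio y = ⋃₀ {V | ∃ c ∈ N, c ≤ y ∧ V = Iio c} := by
          ext x
          constructor
          · intro hx
            obtain ⟨c, hc, hyc, hcx⟩ := h2 x y hx
            exact ⟨_, ⟨c, hc, hcx, rfl⟩, hyc⟩
          · rintro ⟨_, ⟨c, hc, hyc, rfl⟩, hcx⟩
            exact lt_of_lt_of_le hcx hyc
        rw [this]
        refine @isOpen_sUnion _ (generateFrom s) _ ?_
        rintro _ ⟨c, hc, -, rfl⟩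
        exact isOpen_generateFrom_of_mem (Or.inr ⟨c, hc, rfl⟩)
  refine ⟨_, isTopologicalBasis_of_subbasis hs, mk_image_le.trans_lt ?_⟩
  have hscard : #s < κ :=
    (mk_union_le _ _).trans_lt (add_lt_of_lt hunc.le (mk_image_le.trans_lt hN)
      (mk_image_le.trans_lt hN))
  have hsurj : #{f : Set (Set K) | f.Finite ∧ f ⊆ s} ≤ #(Finset s) := by
    classical
    refine mk_le_of_surjective (f := fun F : Finset s => ⟨Subtype.val '' (F : Set s),
      F.finite_toSet.image _, by simp⟩) ?_
    rintro ⟨f, hf, hfs⟩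
    refine ⟨(hf.preimage (f := (Subtype.val : s → Set K))
      Subtype.val_injective.injOn).toFinset, ?_⟩
    simpa [Subtype.ext_iff] using hfs
  refine hsurj.trans_lt ?_
  rcases finite_or_infinite s with hfin | hinf
  · exact (lt_aleph0_of_finite _).trans hunc
  · rwa [mk_finset_of_infinite]

/-! ### Absence of gaps -/

/-- A set `N` closed under left and right reach for a separating sequence of ranks, and under
taking cofinal sets of `Iio x` and coinitial sets of `Ioi x`, meets every interval `[y, x)`. -/
theorem exists_mem_Ico_of_closed {K : Type u} [LinearOrder K] [TopologicalSpace K]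
    [OrderTopology K] [CompactSpace K] {ρ : ℕ → K → Ordinal.{u}}
    (hρ : ∀ n ξ, IsOpen {x | ρ n x < ξ}) (hsep : ∀ x y, x ≠ y → ∃ n, ρ n x ≠ ρ n y)
    {N : Set K} (hbot : ∀ x, IsBot x → x ∈ N) (htop : ∀ x, IsTop x → x ∈ N)
    (hright : ∀ n, ∀ p ∈ N, reachLUBs (ρ n) p ⊆ N)
    (hleft : ∀ n, ∀ p ∈ N, reachLUBs (K := Kᵒᵈ) (ρ n) p ⊆ N)
    (hlc : ∀ x ∈ N, ∀ y < x, ∃ c ∈ N, y ≤ c ∧ c < x)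
    (hrc : ∀ y ∈ N, ∀ x > y, ∃ c ∈ N, y < c ∧ c ≤ x)
    (y x : K) (hyx : y < x) : ∃ c ∈ N, y ≤ c ∧ c < x := by
  by_contra! hno
  have : Nonempty K := ⟨x⟩
  have : CompactSpace Kᵒᵈ := ‹CompactSpace K›
  obtain ⟨m, -, hm⟩ := isCompact_univ.exists_isLeast (univ_nonempty (α := K))
  obtain ⟨M, -, hM⟩ := isCompact_univ.exists_isGreatest (univ_nonempty (α := K))
  have hmN : m ∈ N := hbot m fun z => hm (mem_univ z)
  have hMN : M ∈ N := htop M fun z => hM (mem_univ z)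
  have hyN : y ∉ N := fun h => absurd (hno y h le_rfl) (not_le.2 hyx)
  -- `a = sup S` and `b = inf T` are the ends of the gap of `N` around `[y, x)`.
  let S : Set K := {c | c ∈ N ∧ c < y}
  let T : Set K := {c | c ∈ N ∧ x ≤ c}
  have hS : S.Nonempty := ⟨m, hmN, lt_of_le_of_ne (hm (mem_univ y)) fun h => hyN (h ▸ hmN)⟩
  have hT : T.Nonempty := ⟨M, hMN, hM (mem_univ x)⟩
  obtain ⟨a, ha⟩ := exists_isLUB_of_compactSpace hS
  obtain ⟨b, hb⟩ : ∃ b, IsGLB T b := exists_isLUB_of_compactSpace (K := Kᵒᵈ) hT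
  have hay : a ≤ y := ha.2 fun c hc => hc.2.le
  have hxb : x ≤ b := hb.2 fun c hc => hc.2
  have hab : a < b := hay.trans_lt (hyx.trans_le hxb)
  have hgap : ∀ c ∈ N, c ≤ a ∨ b ≤ c := by
    intro c hc
    rcases lt_or_ge c y with h | h
    · exact Or.inl (ha.1 ⟨hc, h⟩)
    · exact Or.inr (hb.1 ⟨hc, hno c hc h⟩)
  have hr : ∃ r ∈ N, a ≤ r ∧ r ≤ b := by
    obtain ⟨n, hn⟩ := hsep a b hab.ne
    rcases lt_or_gt_of_ne hn with h | h
    · exact exists_reachLUB_mem_Icc (hρ n) (fun c hc => hc.1) hS (hright n) ha hab h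
    · obtain ⟨r, hr, h1, h2⟩ := exists_reachLUB_mem_Icc (K := Kᵒᵈ) (a := OrderDual.toDual b)
        (b := OrderDual.toDual a) (S := OrderDual.ofDual ⁻¹' T) (N := OrderDual.ofDual ⁻¹' N)
        (hρ n) (fun c hc => hc.1) hT (hleft n) hb.dual hab h
      exact ⟨r, hr, h2, h1⟩
  obtain ⟨r, hrN, har, hrb⟩ := hr
  rcases hgap r hrN with h | h
  · obtain rfl : a = r := le_antisymm har h
    have hay' : a < y := lt_of_le_of_ne hay fun h => hyN (h ▸ hrN)
    obtain ⟨c, hc, hac, hcy⟩ := hrc a hrN y hay'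
    rcases hgap c hc with h | h
    · exact absurd h (not_le.2 hac)
    · exact absurd (h.trans hcy) (not_le.2 (hyx.trans_le hxb))
  · obtain rfl : r = b := le_antisymm hrb h
    obtain ⟨c, hc, hyc, hcb⟩ := hlc r hrN y (hyx.trans_le hxb)
    rcases hgap c hc with h | h
    · exact hyN (le_antisymm hyc (h.trans hay) ▸ hc)
    · exact absurd h (not_le.2 hcb)

/-! ### Weight -/

theorem topWeight_lt_iff {K : Type u} [TopologicalSpace K] {κ : Cardinal.{u}} :
    topWeight K < κ ↔ ∃ B : Set (Set K), IsTopologicalBasis B ∧ #B < κ := by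
  have hne : {c | ∃ B : Set (Set K), IsTopologicalBasis B ∧ #B = c}.Nonempty :=
    ⟨_, _, isTopologicalBasis_opens, rfl⟩
  rw [topWeight, csInf_lt_iff (OrderBot.bddBelow _) hne]
  constructor
  · rintro ⟨_, ⟨B, hB, rfl⟩, h⟩
    exact ⟨B, hB, h⟩
  · rintro ⟨B, hB, h⟩
    exact ⟨_, ⟨B, hB, rfl⟩, h⟩

theorem topWeight_lt_of_not_containsCopy {K : Type u} [LinearOrder K] [TopologicalSpace K]
    [OrderTopology K] [CompactSpace K] (hfrag : Fragmentable K) {κ : Cardinal.{u}}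
    (hreg : κ.IsRegular) (hunc : ℵ₀ < κ) (hκ : ¬ ContainsCopy κ.ord K) : topWeight K < κ := by
  rw [topWeight_lt_iff]
  have hκ₁ : IsEmpty (κ.ord.ToType ↪o K) := not_nonempty_iff.1 fun h => hκ (Or.inl h)
  have hκ₂ : IsEmpty (κ.ord.ToType ↪o Kᵒᵈ) := ⟨fun f => hκ (Or.inr ⟨f.dual⟩)⟩
  obtain ⟨ρ, hρ, hsep⟩ := hfrag.exists_ranks
  choose L hL hL' using exists_cofinal_mk_lt hκ₁
  choose R hR hR' using exists_cofinal_mk_lt hκ₂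
  -- `R` and the second `reachLUBs` are taken in `Kᵒᵈ`, whose underlying type is that of `K`.
  let F : K → Set K := fun p => (L p ∪ R p) ∪
    ⋃ n : ULift.{u} ℕ, reachLUBs (ρ n.down) p ∪ reachLUBs (K := Kᵒᵈ) (ρ n.down) p
  have hunion : ∀ A B : Set K, #A < κ → #B < κ → #(A ∪ B : Set K) < κ := fun A B hA hB =>
    (mk_union_le _ _).trans_lt (add_lt_of_lt hunc.le hA hB)
  have hF : ∀ p, #(F p) < κ := fun p => by
    refine hunion _ _ (hunion _ _ (hL p) (hR p)) ?_
    refine (card_iUnion_lt_iff_forall_of_isRegular hreg (by simpa using hunc)).2 fun n => ?_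
    exact hunion _ _ ((isWF_reachLUBs _ _).mk_lt_of_isEmpty hκ₁)
      ((isWF_reachLUBs (K := Kᵒᵈ) _ _).mk_lt_of_isEmpty hκ₂)
  have hends : #({x : K | IsBot x} ∪ {x : K | IsTop x} : Set K) < κ := by
    refine lt_trans (lt_aleph0_iff_set_finite.2 (Finite.union ?_ ?_)) hunc
    · exact (subsingleton_isBot K).finite
    · exact (subsingleton_isTop K).finite
  obtain ⟨N, hN, hNκ, hNF⟩ := exists_superset_closed_mk_lt hreg hunc hF hends
  have hlc : ∀ x ∈ N, ∀ y < x, ∃ c ∈ N, y ≤ c ∧ c < x := fun x hx y hy => by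
    obtain ⟨c, hc, h⟩ := hL' x y hy
    exact ⟨c, hNF x hx (Or.inl (Or.inl hc)), h⟩
  have hrc : ∀ y ∈ N, ∀ x > y, ∃ c ∈ N, y < c ∧ c ≤ x := fun y hy x hx => by
    obtain ⟨c, hc, h⟩ := hR' y x hx
    exact ⟨c, hNF y hy (Or.inl (Or.inr hc)), h.2, h.1⟩
  have hreach : ∀ n, ∀ p ∈ N, reachLUBs (ρ n) p ∪ reachLUBs (K := Kᵒᵈ) (ρ n) p ⊆ N :=
    fun n p hp c hc => hNF p hp (Or.inr (mem_iUnion.2 ⟨⟨n⟩, hc⟩))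
  have h1 := exists_mem_Ico_of_closed hρ hsep (fun x hx => hN (Or.inl hx))
    (fun x hx => hN (Or.inr hx)) (fun n p hp => subset_union_left.trans (hreach n p hp))
    (fun n p hp => subset_union_right.trans (hreach n p hp)) hlc hrc
  refine isTopologicalBasis_mk_lt hunc hNκ h1 fun y x hyx => ?_
  obtain ⟨c, hc, hyc, hcx⟩ := h1 y x hyx
  rcases hyc.eq_or_lt with rfl | hlt
  · exact hrc y hc x hyx
  · exact ⟨c, hc, hlt, hcx.le⟩

theorem proposition1p4 (K : Type u) [LinearOrder K] [TopologicalSpace K] [OrderTopology K]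
    [CompactSpace K] (hfrag : Fragmentable K) :
    (∀ κ : Cardinal.{u}, κ.IsRegular → ℵ₀ < κ → ¬ ContainsCopy κ.ord K → topWeight K < κ) ∧
      (¬ ContainsCopy (ω₁ : Ordinal.{u}) K → MetrizableSpace K) := by
  refine ⟨fun κ hreg hunc hκ => topWeight_lt_of_not_containsCopy hfrag hreg hunc hκ, fun h => ?_⟩
  rw [← ord_aleph] at h
  obtain ⟨B, hB, hBc⟩ := topWeight_lt_iff.1
    (topWeight_lt_of_not_containsCopy hfrag isRegular_aleph_one aleph0_lt_aleph_one h)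
  have hcount : B.Countable := by
    rwa [← succ_aleph0, Order.lt_succ_iff, le_aleph0_iff_set_countable] at hBc
  have : SecondCountableTopology K := hB.secondCountableTopology hcount
  infer_instance
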